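/- Let $\mathbf F_q$ be a finite field with $q$ elements, $K=\mathbf F_q((x))$ the field of formal Laurent series with the absolute value $|z|=q^{-n}$ for $z=\sum_{i\ge n}a_ix^i$, $a_n\neq 0$, and $O=\{z\in K:|z|\le 1\}$. Let $K_{ac}$ be an algebraic closure of $K$ with the unique absolute value extending $|\cdot|$, let $\overline K$ be the completion of $K_{ac}$, and let $C(O,\overline K)$ be the Banach space of continuous functions $O\to\overline K$ with the supremum norm. For $i\ge 0$ put $$e_i(t)=\prod_{m\in\mathbf F_q[x],\ \deg m<i}(t-m)\quad(\text{so } e_0(t)=t),\qquad D_i=\prod_{k=1}^{i}\bigl(x^{q^k}-x\bigr)^{q^{i-k}}\quad(D_0=1).$$ For an integer $j\ge 0$ with base-$q$ expansion $j=\sum_{i=0}^{\nu}\alpha_iq^i$, $0\le\alpha_i<q$, put $$h_j(t)=\frac{\prod_{i=0}^{\nu}e_i(t)^{\alpha_i}}{\prod_{i=0}^{\nu}D_i^{\alpha_i}},\qquad t\in O .$$ Then $\{h_j\}_{j\ge 0}$ is an orthonormal basis of $C(O,\overline K)$ in the non-Archimedean sense: every $\varphi\in C(O,\overline K)$ has a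 unique expansion into a uniformly convergent series $\varphi=\sum_{j=0}^{\infty}c_jh_j$ with $c_j\in\overline K$, $c_j\to 0$, and for this expansion $$\|\varphi\|=\sup_{j\ge 0}|c_j| .$$ -/

import Mathlib

open Filter Topology

namespace Carlitz

/-! ### The local field `K` of formal Laurent series over a finite field -/

section LocalField

variable (F : Type*) [Field F] [Finite F]

theorem one_lt_card : (1 : NNReal) < (Nat.card F : NNReal) := by
  exact_mod_cast Finite.one_lt_card (α := F)

/-- The `x`-adic valuation on `K = F((x))`, made real valued by sending `x` to `q⁻¹`, `q = #F`. -/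
noncomputable instance rankOneValuation :
    (Valued.v : Valuation (LaurentSeries F) (WithZero (Multiplicative ℤ))).RankOne where
  hom' := (WithZeroMulInt.toNNReal (one_lt_card F).ne_zero).comp
    MonoidWithZeroHom.ValueGroup₀.embedding
  strictMono' := (WithZeroMulInt.toNNReal_strictMono (one_lt_card F)).comp
    MonoidWithZeroHom.ValueGroup₀.embedding_strictMono
  exists_val_nontrivial := by
    refine ⟨HahnSeries.single 1 1, ?_, ?_⟩
    · simp
    · have h := LaurentSeries.valuation_single_zpow F 1
      rw [h, ← WithZero.exp_zero]
      intro h'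
      have := WithZero.exp_injective h'
      omega

/-- The absolute value on `K = F((x))`, inducing the `x`-adic topology. By `norm_eq_card_zpow` it is
`|z| = q⁻ⁿ` for `z = ∑_{i ≥ n} aᵢ xⁱ` with `aₙ ≠ 0`. -/
noncomputable instance instNontriviallyNormedField :
    NontriviallyNormedField (LaurentSeries F) :=
  Valued.toNontriviallyNormedField (LaurentSeries F) (WithZero (Multiplicative ℤ))

instance instIsUltrametricDist : IsUltrametricDist (LaurentSeries F) :=
  Valued.instIsUltrametricDist (LaurentSeries F) (WithZero (Multiplicative ℤ))

variable {F}

theorem norm_eq_toNNReal (z : LaurentSeries F) :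
    ‖z‖ = WithZeroMulInt.toNNReal (one_lt_card F).ne_zero (Valued.v z) := by
  have h := Valuation.embedding_restrict
    (Valued.v : Valuation (LaurentSeries F) (WithZero (Multiplicative ℤ))) z
  exact congrArg (fun t => ((WithZeroMulInt.toNNReal (one_lt_card F).ne_zero t : NNReal) : ℝ)) h

theorem toNNReal_exp {e : NNReal} (he : e ≠ 0) (n : ℤ) :
    WithZeroMulInt.toNNReal he (WithZero.exp n) = e ^ n := by
  rw [WithZeroMulInt.toNNReal_neg_apply he WithZero.exp_ne_zero]
  rfl

theorem norm_le_card_zpow_iff {z : LaurentSeries F} {D : ℤ} :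
    ‖z‖ ≤ (Nat.card F : ℝ) ^ (-D) ↔ ∀ n : ℤ, n < D → z.coeff n = 0 := by
  rw [← LaurentSeries.valuation_le_iff_coeff_lt_eq_zero,
    ← (WithZeroMulInt.toNNReal_strictMono (one_lt_card F)).le_iff_le, toNNReal_exp,
    norm_eq_toNNReal, ← NNReal.coe_le_coe]
  simp

theorem norm_eq_card_zpow {z : LaurentSeries F} (hz : z ≠ 0) :
    ‖z‖ = (Nat.card F : ℝ) ^ (-z.order) := by
  refine le_antisymm
    (norm_le_card_zpow_iff.2 fun n hn => HahnSeries.coeff_eq_zero_of_lt_order hn) ?_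
  by_contra! h
  have hv : Valued.v z ≠ 0 := (Valuation.ne_zero_iff _).2 hz
  obtain ⟨m, hm⟩ : ∃ m : ℤ, Valued.v z = WithZero.exp (-m) :=
    ⟨-WithZero.log (Valued.v z), by rw [neg_neg, WithZero.exp_log hv]⟩
  have hzm : ‖z‖ = (Nat.card F : ℝ) ^ (-m) := by
    rw [norm_eq_toNNReal, hm, toNNReal_exp]
    simp
  have hq : (1 : ℝ) < Nat.card F := by exact_mod_cast Finite.one_lt_card (α := F)
  rw [hzm, zpow_lt_zpow_iff_right₀ hq] at h
  exact hz (HahnSeries.coeff_order_eq_zero.1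
    (norm_le_card_zpow_iff.1 hzm.le z.order (by omega)))

variable (F)

/-- The ring of integers `O = {z ∈ K : |z| ≤ 1}`, as a metric subspace of `K`. -/
abbrev Integers : Set (LaurentSeries F) := Metric.closedBall 0 1

/-- `O` is compact, so that continuous functions on `O` carry the supremum norm. -/
instance instCompactSpaceIntegers : CompactSpace (Integers F) := by
  rw [← isCompact_iff_compactSpace]
  let _ : TopologicalSpace F := ⊥
  have : DiscreteTopology F := ⟨rfl⟩
  let φ : (ℕ → F) → LaurentSeries F := fun a => HahnSeries.ofPowerSeries ℤ F (PowerSeries.mk a)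
  have hq : (1 : ℝ) < Nat.card F := by exact_mod_cast Finite.one_lt_card (α := F)
  have hcoeff : ∀ (a : ℕ → F) (n : ℕ), (φ a).coeff n = a n := fun a n => by
    simp [φ]
  have hneg : ∀ (a : ℕ → F) (n : ℤ), n < 0 → (φ a).coeff n = 0 := fun a n hn => by
    simp only [φ]
    rw [HahnSeries.ofPowerSeries_apply]
    apply HahnSeries.embDomain_of_notMem_range
    rintro ⟨k, hk⟩
    have : (k : ℤ) = n := hk
    omega
  have hφ : Continuous φ := by
    rw [continuous_iff_continuousAt]
    intro a
    rw [ContinuousAt, Metric.tendsto_nhds]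
    intro ε hε
    obtain ⟨N, hN⟩ := exists_pow_lt_of_lt_one hε (inv_lt_one_of_one_lt₀ hq)
    have hev : ∀ᶠ b in 𝓝 a, ∀ i ∈ Finset.range N, b i = a i := by
      rw [Filter.eventually_all_finset]
      intro i _
      exact (continuous_apply i).continuousAt.eventually_mem
        ((isOpen_discrete {a i}).mem_nhds rfl)
    filter_upwards [hev] with b hb
    rw [dist_eq_norm]
    refine lt_of_le_of_lt ?_ hN
    have := (norm_le_card_zpow_iff (z := φ b - φ a) (D := N)).2 ?_
    · simpa using this
    · intro n hn
      rw [HahnSeries.coeff_sub]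
      rcases lt_or_ge n 0 with h | h
      · simp [hneg _ _ h]
      · obtain ⟨k, rfl⟩ := Int.eq_ofNat_of_zero_le h
        rw [hcoeff, hcoeff, hb k (by simpa using hn), sub_self]
  have hrange : Integers F = Set.range φ := by
    ext z
    have h1 := norm_le_card_zpow_iff (z := z) (D := 0)
    simp only [neg_zero, zpow_zero] at h1
    rw [Metric.mem_closedBall, dist_zero_right, h1]
    constructor
    · intro h
      refine ⟨fun n => z.coeff n, ?_⟩
      ext n
      rcases lt_or_ge n 0 with hn | hn
      · rw [hneg _ _ hn, h n hn]
      · obtain ⟨k, rfl⟩ := Int.eq_ofNat_of_zero_le hn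
        rw [hcoeff]
    · rintro ⟨a, rfl⟩ n hn
      exact hneg a n hn
  rw [hrange]
  exact isCompact_range hφ

end LocalField

/-! ### The completion `K̄` of an algebraic closure of `K` -/

section AlgClosure

variable (F : Type*) [Field F] [Finite F]

/-- An algebraic closure `K_ac` of `K`. -/
abbrev AlgClosure := AlgebraicClosure (LaurentSeries F)

/-- The absolute value on `K_ac`: the unique extension of the absolute value of `K`. -/
noncomputable instance instNormedFieldAlgClosure : NormedField (AlgClosure F) :=
  spectralNorm.normedField (LaurentSeries F) (AlgClosure F)

/-- The field `K̄`, the completion of `K_ac`. -/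
abbrev CompletedAlgClosure := UniformSpace.Completion (AlgClosure F)

variable {F}

/-- The embedding of `K` into `K̄`. -/
noncomputable def embed (z : LaurentSeries F) : CompletedAlgClosure F :=
  ((algebraMap (LaurentSeries F) (AlgClosure F) z : AlgClosure F) : CompletedAlgClosure F)

theorem norm_embed (z : LaurentSeries F) : ‖embed z‖ = ‖z‖ := by
  rw [embed, UniformSpace.Completion.norm_coe]
  exact spectralNorm_extends z

theorem continuous_embed : Continuous (embed (F := F)) := by
  refine Isometry.continuous (Isometry.of_dist_eq fun a b => ?_)
  have h : embed a - embed b = embed (a - b) := by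
    simp only [embed, map_sub, UniformSpace.Completion.coe_sub]
  rw [dist_eq_norm, h, norm_embed, dist_eq_norm]

end AlgClosure

/-! ### The extended Carlitz polynomials -/

section Polynomials

variable (F : Type*) [Field F] [Finite F]

/-- The indeterminate `x`, as an element of `K = F((x))`. -/
noncomputable def indet : LaurentSeries F := HahnSeries.single 1 1

/-- `[i] = x^{q^i} - x`. -/
noncomputable def bracket (i : ℕ) : LaurentSeries F := indet F ^ Nat.card F ^ i - indet F

/-- `D_i = [i] [i-1]^q ⋯ [1]^{q^{i-1}}`, `D_0 = 1`. -/
noncomputable def D (i : ℕ) : LaurentSeries F :=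
  ∏ k ∈ Finset.Icc 1 i, bracket F k ^ Nat.card F ^ (i - k)

/-- `e_i(t) = ∏ (t - m)` over all polynomials `m ∈ F[x]` of degree less than `i`; for `i = 0` only
`m = 0` occurs and `e_0(t) = t`. -/
noncomputable def e (i : ℕ) (t : LaurentSeries F) : LaurentSeries F :=
  ∏ᶠ m ∈ {m : Polynomial F | m.degree < i}, (t - Polynomial.aeval (indet F) m)

/-- The digit `α_i` in the expansion `j = ∑ α_i q^i`, `0 ≤ α_i < q`. -/
noncomputable def digit (j i : ℕ) : ℕ := j / Nat.card F ^ i % Nat.card F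

/-- `G_j(t) = ∏_{i ≤ ν} e_i(t)^{α_i}`, where `q^ν` is the highest power of `q` occurring in `j`. -/
noncomputable def G (j : ℕ) (t : LaurentSeries F) : LaurentSeries F :=
  ∏ i ∈ Finset.range (Nat.log (Nat.card F) j + 1), e F i t ^ digit F j i

/-- `Γ_j = ∏_{i ≤ ν} D_i^{α_i}`. -/
noncomputable def Gam (j : ℕ) : LaurentSeries F :=
  ∏ i ∈ Finset.range (Nat.log (Nat.card F) j + 1), D F i ^ digit F j i


theorem finite_degree_lt (i : ℕ) : {m : Polynomial F | m.degree < i}.Finite := by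
  have : Finite (Polynomial.degreeLT F i) :=
    Finite.of_equiv _ (Polynomial.degreeLTEquiv F i).symm.toEquiv
  exact Set.Finite.subset (Set.toFinite (Polynomial.degreeLT F i : Set (Polynomial F)))
    fun m hm => Polynomial.mem_degreeLT.2 hm

theorem continuous_e (i : ℕ) : Continuous (e F i) := by
  have h : e F i = fun t => ∏ m ∈ (finite_degree_lt F i).toFinset,
      (t - Polynomial.aeval (indet F) m) :=
    funext fun t => finprod_mem_eq_finite_toFinset_prod _ _
  rw [h]
  fun_prop

theorem continuous_G (j : ℕ) : Continuous (G F j) :=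
  continuous_finsetProd _ fun i _ => (continuous_e F i).pow _

/-- `h_j = G_j / Γ_j`, as a continuous function on `O` with values in `K̄`. -/
noncomputable def h (j : ℕ) : C(Integers F, CompletedAlgClosure F) where
  toFun t := embed (G F j t / Gam F j)
  continuous_toFun :=
    continuous_embed.comp (((continuous_G F j).comp continuous_subtype_val).div_const _)

end Polynomials

/-! ### Orthonormal bases in the non-Archimedean sense -/

section Basis

variable {𝕜 E : Type*} [NormedField 𝕜] [NormedAddCommGroup E] [NormedSpace 𝕜 E]

/-- `v = ∑_j c_j b_j` as a convergent series in `E`, with coefficients `c_j → 0`. -/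
def IsExpansion (b : ℕ → E) (c : ℕ → 𝕜) (v : E) : Prop :=
  Tendsto c atTop (𝓝 0) ∧ Tendsto (fun n => ∑ j ∈ Finset.range n, c j • b j) atTop (𝓝 v)

variable (𝕜) in
/-- `b` is an orthonormal basis of `E` in the non-Archimedean sense: every `v ∈ E` has a unique
expansion `v = ∑_j c_j b_j` with `c_j → 0`, and then `‖v‖ = sup_j |c_j|`. -/
structure IsOrthonormalBasis (b : ℕ → E) : Prop where
  existsUnique_expansion : ∀ v : E, ∃! c : ℕ → 𝕜, IsExpansion b c v
  norm_eq_sup : ∀ (v : E) (c : ℕ → 𝕜), IsExpansion b c v → IsLUB (Set.range fun j => ‖c j‖) ‖v‖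

end Basis

end Carlitz

namespace Carlitz

/-! Write `t = ∑ tᵢ xⁱ`. Modulo the maximal ideal, `e_i(t) / D_i` is the coefficient `tᵢ`
(`congr_e_div_D`), so for `j < qⁿ` the function `h_j` reduces to the monomial `∏ tᵢ^{αᵢ}` in `t₀, …,
t_{n-1}`, with every exponent below `q` (`congr_G_div_Gam`). These reduced monomials form a basis of
the functions `Fⁿ → F`. The change-of-basis matrices have entries in `F`, hence of norm at most `1`,
so passing between values and coefficients loses nothing in norm.

Since `K` is discretely valued, the congruences hold up to `q⁻¹` uniformly in `t` and `j`.
Orthonormality is thus inherited from the monomials: an error of `q⁻¹` times the largest coefficient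
cannot hide that coefficient (`norm_coeff_le_norm_sum_h`). For density, uniform continuity makes `φ`
depend on finitely many `tᵢ` up to `‖φ‖ / q`; interpolating by monomials and replacing them by the
`h_j` shrinks the remainder by a factor `q`, and the process is iterated
(`exists_mem_span_norm_sub_le`). A general ultrametric criterion, `isOrthonormalBasis_of_dense`,
concludes. -/

theorem norm_sub_le_max {A : Type*} [SeminormedAddCommGroup A] [IsUltrametricDist A] (x y : A) :
    ‖x - y‖ ≤ max ‖x‖ ‖y‖ := by
  simpa [sub_eq_add_neg] using IsUltrametricDist.norm_add_le_max x (-y)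

/-! ### An ultrametric criterion for orthonormal bases. -/

section Basis

variable {𝕜 E : Type*} [NormedField 𝕜] [NormedAddCommGroup E] [NormedSpace 𝕜 E]

theorem norm_sum_smul_le [IsUltrametricDist E] {b : ℕ → E} (hb : ∀ j, ‖b j‖ ≤ 1) {c : ℕ → 𝕜}
    {n : ℕ} {B : ℝ} (hB : 0 ≤ B) (hc : ∀ j < n, ‖c j‖ ≤ B) :
    ‖∑ j ∈ Finset.range n, c j • b j‖ ≤ B := by
  refine IsUltrametricDist.norm_sum_le_of_forall_le_of_nonneg hB fun j hj => ?_
  rw [norm_smul]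
  exact (mul_le_of_le_one_right (norm_nonneg _) (hb j)).trans (hc j (Finset.mem_range.1 hj))

/-- The non-Archimedean analogue of "a total orthonormal system is an orthonormal basis". -/
theorem isOrthonormalBasis_of_dense [IsUltrametricDist E] [CompleteSpace 𝕜] {b : ℕ → E}
    (hb : ∀ j, ‖b j‖ ≤ 1)
    (hlow : ∀ (n : ℕ) (c : ℕ → 𝕜), ∀ j < n, ‖c j‖ ≤ ‖∑ i ∈ Finset.range n, c i • b i‖)
    (hdense : ∀ (v : E) (ε : ℝ), 0 < ε →
      ∃ (n : ℕ) (c : ℕ → 𝕜), ‖v - ∑ i ∈ Finset.range n, c i • b i‖ ≤ ε) :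
    IsOrthonormalBasis 𝕜 b := by
  have hle : ∀ (v : E) (c : ℕ → 𝕜), IsExpansion b c v → ∀ j, ‖c j‖ ≤ ‖v‖ := by
    intro v c hc j
    refine ge_of_tendsto hc.2.norm ?_
    filter_upwards [eventually_gt_atTop j] with n hn using hlow n c j hn
  refine ⟨fun v => existsUnique_of_exists_of_unique ?_ ?_, ?_⟩
  · have hpos : ∀ k : ℕ, (0 : ℝ) < 1 / ((k : ℝ) + 1) := fun k => by positivity
    have hex : ∀ k : ℕ, ∃ (n : ℕ) (c : ℕ → 𝕜), (∀ j ≥ n, c j = 0) ∧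
        ∀ m ≥ n, ‖v - ∑ i ∈ Finset.range m, c i • b i‖ ≤ 1 / ((k : ℝ) + 1) := by
      intro k
      obtain ⟨n, c, hc⟩ := hdense v _ (hpos k)
      -- Truncation makes the partial sums constant from `n` on, so that two approximants can be
      -- compared at a common length.
      refine ⟨n, fun i => if i < n then c i else 0, fun j hj => by simp [hj.not_gt], ?_⟩
      intro m hm
      convert hc using 3
      rw [← Finset.sum_subset (Finset.range_subset_range.2 hm)]
      · exact Finset.sum_congr rfl fun i hi => by simp [Finset.mem_range.1 hi]
      · intro i _ hi
        simp [not_lt.1 (Finset.mem_range.not.1 hi) |>.not_gt]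
    choose N C hC0 hC using hex
    -- The lower bound turns closeness of approximants in `E` into closeness of coefficients,
    -- uniformly in `j`; this uniformity later gives `c j → 0`.
    have hdiff : ∀ k l j, ‖C k j - C l j‖ ≤ max (1 / ((k : ℝ) + 1)) (1 / ((l : ℝ) + 1)) := by
      intro k l j
      let m := max (j + 1) (max (N k) (N l))
      refine (hlow m (fun j => C k j - C l j) j (by simp [m])).trans ?_
      have h1 := hC k m (by simp [m])
      have h2 := hC l m (by simp [m])
      have : ∑ i ∈ Finset.range m, (C k i - C l i) • b i =
          (v - ∑ i ∈ Finset.range m, C l i • b i) - (v - ∑ i ∈ Finset.range m, C k i • b i) := by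
        simp only [sub_smul, Finset.sum_sub_distrib]
        abel
      rw [this]
      exact (norm_sub_le_max _ _).trans
        (max_le (h2.trans (le_max_right _ _)) (h1.trans (le_max_left _ _)))
    have hδ : Tendsto (fun k : ℕ => 1 / ((k : ℝ) + 1)) atTop (𝓝 0) :=
      tendsto_one_div_add_atTop_nhds_zero_nat
    have hlim : ∀ j, ∃ x, Tendsto (fun k => C k j) atTop (𝓝 x) := by
      intro j
      refine cauchySeq_tendsto_of_complete (cauchySeq_of_le_tendsto_0 _ ?_ hδ)
      intro n m K hn hm
      rw [dist_eq_norm]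
      exact (hdiff n m j).trans (max_le (Nat.one_div_le_one_div hn) (Nat.one_div_le_one_div hm))
    choose c hc using hlim
    have hCc : ∀ k j, ‖C k j - c j‖ ≤ 1 / ((k : ℝ) + 1) := by
      intro k j
      refine le_of_tendsto (tendsto_const_nhds.sub (hc j)).norm ?_
      filter_upwards [eventually_ge_atTop k] with l hl
      exact (hdiff k l j).trans (max_le le_rfl (Nat.one_div_le_one_div hl))
    refine ⟨c, ?_, ?_⟩
    · rw [Metric.tendsto_atTop]
      intro ε hε
      obtain ⟨k, hk⟩ := (hδ.eventually_lt_const hε).exists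
      refine ⟨N k, fun j hj => lt_of_le_of_lt ?_ hk⟩
      have := hCc k j
      rwa [hC0 k j hj, zero_sub, norm_neg, ← dist_zero_right] at this
    · rw [Metric.tendsto_atTop]
      intro ε hε
      obtain ⟨k, hk⟩ := (hδ.eventually_lt_const hε).exists
      refine ⟨N k, fun m hm => lt_of_le_of_lt ?_ hk⟩
      have h1 := hC k m hm
      have h2 := norm_sum_smul_le hb (c := fun j => C k j - c j) (n := m) (hpos k).le
        fun j _ => hCc k j
      have : v - ∑ i ∈ Finset.range m, c i • b i =
          (v - ∑ i ∈ Finset.range m, C k i • b i) +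
            ∑ i ∈ Finset.range m, (C k i - c i) • b i := by
        simp only [sub_smul, Finset.sum_sub_distrib]
        abel
      rw [dist_comm, dist_eq_norm, this]
      exact (IsUltrametricDist.norm_add_le_max _ _).trans (max_le h1 h2)
  · intro c c' hc hc'
    have h0 : IsExpansion b (fun j => c j - c' j) (0 : E) := by
      refine ⟨by simpa using hc.1.sub hc'.1, ?_⟩
      simpa [sub_smul] using hc.2.sub hc'.2
    funext j
    have := hle _ _ h0 j
    rw [norm_zero] at this
    exact sub_eq_zero.1 (norm_le_zero_iff.1 this)
  · intro v c hc
    refine ⟨?_, fun B hB => ?_⟩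
    · rintro _ ⟨j, rfl⟩
      exact hle v c hc j
    · have hB' : ∀ j, ‖c j‖ ≤ B := fun j => hB ⟨j, rfl⟩
      exact le_of_tendsto hc.2.norm (Eventually.of_forall fun n =>
        norm_sum_smul_le hb ((norm_nonneg _).trans (hB' 0)) fun j _ => hB' j)

end Basis

/-! ### Base-`q` digits as exponent vectors. -/

section DigitMonomial

variable {F : Type*} [Field F]

/-- `∏_{i < n} aᵢ^{αᵢ}`, where `αᵢ` are the digits of `j`. -/
noncomputable def digitMonomial (n j : ℕ) (a : Fin n → F) : F := ∏ i, a i ^ digit F j i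

theorem sum_digitMonomial {A : Type*} [AddCommMonoid A] (n : ℕ) (c : ℕ → F → A) (a : Fin n → F) :
    ∑ j ∈ Finset.range (Nat.card F ^ n), c j (digitMonomial n j a) =
      ∑ k : Fin n → Fin (Nat.card F), c (finFunctionFinEquiv k) (∏ i, a i ^ (k i : ℕ)) := by
  rw [Finset.sum_range, ← finFunctionFinEquiv.sum_comp]
  refine Finset.sum_congr rfl fun k _ => ?_
  congr 1
  refine Finset.prod_congr rfl fun i _ => ?_
  congr 1
  have := congrArg Fin.val (congrFun (finFunctionFinEquiv.symm_apply_apply k) i)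
  rw [← this]
  rfl

end DigitMonomial

/-! ### Interpolation on `Fⁿ` by reduced monomials. -/

section Monomials

variable (F : Type*) [Field F] [Finite F]

theorem exists_inverse_vandermonde [Fintype F] [DecidableEq F] :
    ∃ W : F → Fin (Nat.card F) → F,
      (∀ k l : Fin (Nat.card F), ∑ a, W a k * a ^ (l : ℕ) = if k = l then 1 else 0) ∧
      ∀ a b : F, ∑ k : Fin (Nat.card F), a ^ (k : ℕ) * W b k = if a = b then 1 else 0 := by
  let v := (Finite.equivFin F).symm
  let V := Matrix.vandermonde v
  have hV : IsUnit V.det :=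
    isUnit_iff_ne_zero.2 (Matrix.det_vandermonde_ne_zero_iff.2 v.injective)
  refine ⟨fun a k => V⁻¹ k (v.symm a), fun k l => ?_, fun a b => ?_⟩
  · rw [← v.sum_comp]
    have := congrFun (congrFun (Matrix.nonsing_inv_mul V hV) k) l
    simpa [Matrix.mul_apply, Matrix.one_apply, V, Matrix.vandermonde_apply] using this
  · have := congrFun (congrFun (Matrix.mul_nonsing_inv V hV) (v.symm a)) (v.symm b)
    simpa [Matrix.mul_apply, Matrix.one_apply, V, Matrix.vandermonde_apply] using this

/-- Reduced monomials in `n` variables, evaluated on `Fⁿ`, form an invertible matrix. -/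
theorem exists_inverse_monomials [Fintype F] [DecidableEq F] (n : ℕ) :
    ∃ W : Matrix (Fin n → Fin (Nat.card F)) (Fin n → F) F,
      W * Matrix.of (fun (a : Fin n → F) (k : Fin n → Fin (Nat.card F)) => ∏ i, a i ^ (k i : ℕ)) = 1 ∧
      Matrix.of (fun (a : Fin n → F) (k : Fin n → Fin (Nat.card F)) => ∏ i, a i ^ (k i : ℕ)) * W = 1 := by
  obtain ⟨w, h1, h2⟩ := exists_inverse_vandermonde F
  -- The monomial matrix is the `n`-th tensor power of the Vandermonde matrix on `F`, so its inverse
  -- is the tensor power of the inverse.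
  refine ⟨Matrix.of fun k a => ∏ i, w (a i) (k i), ?_, ?_⟩
  · ext k l
    simp only [Matrix.mul_apply, Matrix.of_apply, ← Finset.prod_mul_distrib, Matrix.one_apply]
    have := Finset.prod_univ_sum (fun _ : Fin n => (Finset.univ : Finset F))
      (fun i a => w a (k i) * a ^ (l i : ℕ))
    rw [Fintype.piFinset_univ] at this
    rw [← this]
    simp only [h1, Finset.prod_ite_zero, Finset.prod_const_one, funext_iff, Finset.mem_univ,
      true_imp_iff]
  · ext a b
    simp only [Matrix.mul_apply, Matrix.of_apply, ← Finset.prod_mul_distrib, Matrix.one_apply]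
    have := Finset.prod_univ_sum (fun _ : Fin n => (Finset.univ : Finset (Fin (Nat.card F))))
      (fun i k => a i ^ (k : ℕ) * w (b i) k)
    rw [Fintype.piFinset_univ] at this
    rw [← this]
    simp only [h2, Finset.prod_ite_zero, Finset.prod_const_one, funext_iff, Finset.mem_univ,
      true_imp_iff]

variable {F}

/-- Nonzero elements of a finite field are roots of unity. -/
theorem norm_map_le_one {L : Type*} [NormedField L] (ι : F →+* L) (x : F) : ‖ι x‖ ≤ 1 := by
  by_cases hx : x = 0
  · simp [hx]
  · obtain ⟨n, hn, h⟩ := isOfFinOrder_iff_pow_eq_one.1 (isOfFinOrder_of_finite (Units.mk0 x hx))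
    have h' : x ^ n = 1 := by simpa using congrArg Units.val h
    refine (pow_le_one_iff_of_nonneg (norm_nonneg _) hn.ne').1 ?_
    rw [← norm_pow, ← map_pow, h', map_one, norm_one]

variable {L : Type*} [NormedField L] [IsUltrametricDist L]

/-- The inverse matrix has entries in `ι F`, of norm at most `1`, so by the ultrametric inequality
recovering coefficients from values costs no constant. -/
theorem norm_le_of_sum_digitMonomial_le (ι : F →+* L) {n : ℕ} {c : ℕ → L} {B : ℝ}
    (h : ∀ a : Fin n → F,
      ‖∑ j ∈ Finset.range (Nat.card F ^ n), c j * ι (digitMonomial n j a)‖ ≤ B)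
    {j : ℕ} (hj : j < Nat.card F ^ n) : ‖c j‖ ≤ B := by
  classical
  let _ := Fintype.ofFinite F
  obtain ⟨W, hW, -⟩ := exists_inverse_monomials F n
  set M := Matrix.of (fun (a : Fin n → F) (k : Fin n → Fin (Nat.card F)) => ∏ i, a i ^ (k i : ℕ))
  have hB : 0 ≤ B := (norm_nonneg _).trans (h 0)
  obtain ⟨k, hk⟩ := (finFunctionFinEquiv (m := Nat.card F) (n := n)).surjective ⟨j, hj⟩
  let d : (Fin n → Fin (Nat.card F)) → L := fun k => c (finFunctionFinEquiv k)
  have hMd : ∀ a, ‖(M.map ι).mulVec d a‖ ≤ B := by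
    intro a
    convert h a using 2
    rw [sum_digitMonomial n (fun j x => c j * ι x)]
    simp [Matrix.mulVec, dotProduct, M, d, mul_comm]
  have hd : (W.map ι).mulVec ((M.map ι).mulVec d) = d := by
    rw [Matrix.mulVec_mulVec, ← Matrix.map_mul, hW, Matrix.map_one _ (map_zero ι) (map_one ι),
      Matrix.one_mulVec]
  have hjk : c j = d k := by simp only [d, hk]
  rw [hjk, ← hd]
  refine IsUltrametricDist.norm_sum_le_of_forall_le_of_nonneg hB fun a _ => ?_
  rw [norm_mul]
  exact (mul_le_of_le_one_left (norm_nonneg _) (norm_map_le_one ι _)).trans (hMd a)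

theorem exists_sum_digitMonomial_eq (ι : F →+* L) {n : ℕ} {f : (Fin n → F) → L} {B : ℝ}
    (hf : ∀ a, ‖f a‖ ≤ B) :
    ∃ c : ℕ → L, (∀ j < Nat.card F ^ n, ‖c j‖ ≤ B) ∧
      ∀ a, ∑ j ∈ Finset.range (Nat.card F ^ n), c j * ι (digitMonomial n j a) = f a := by
  classical
  let _ := Fintype.ofFinite F
  obtain ⟨W, -, hW⟩ := exists_inverse_monomials F n
  set M := Matrix.of (fun (a : Fin n → F) (k : Fin n → Fin (Nat.card F)) => ∏ i, a i ^ (k i : ℕ))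
  let d := (W.map ι).mulVec f
  have hd : (M.map ι).mulVec d = f := by
    rw [Matrix.mulVec_mulVec, ← Matrix.map_mul, hW, Matrix.map_one _ (map_zero ι) (map_one ι),
      Matrix.one_mulVec]
  let c : ℕ → L := fun j => if h : j < Nat.card F ^ n then d (finFunctionFinEquiv.symm ⟨j, h⟩) else 0
  have hcd : ∀ k, c (finFunctionFinEquiv k) = d k := fun k => by
    simp only [c, dif_pos (Fin.is_lt _), Fin.eta, Equiv.symm_apply_apply]
  have hsum : ∀ a, ∑ j ∈ Finset.range (Nat.card F ^ n), c j * ι (digitMonomial n j a) = f a := by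
    intro a
    rw [sum_digitMonomial n (fun j x => c j * ι x)]
    conv_rhs => rw [← hd]
    simp only [hcd]
    simp [Matrix.mulVec, dotProduct, M, mul_comm]
  refine ⟨c, fun j hj => norm_le_of_sum_digitMonomial_le ι (fun a => ?_) hj, hsum⟩
  rw [hsum]
  exact hf a

end Monomials

/-! ### Congruence modulo the maximal ideal. -/

section Congruence

variable {L : Type*} [NormedField L] [IsUltrametricDist L]

/-- `a` and `b` are integral and congruent modulo the maximal ideal. -/
def Congr {L : Type*} [NormedField L] (a b : L) : Prop := ‖b‖ ≤ 1 ∧ ‖a - b‖ < 1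

theorem Congr.norm_le_one {a b : L} (h : Congr a b) : ‖a‖ ≤ 1 := by
  have := IsUltrametricDist.norm_add_le_max (a - b) b
  rw [sub_add_cancel] at this
  exact this.trans (max_le h.2.le h.1)

theorem congr_refl {L : Type*} [NormedField L] {a : L} (h : ‖a‖ ≤ 1) : Congr a a := ⟨h, by simp⟩

theorem Congr.mul {a b a' b' : L} (h : Congr a b) (h' : Congr a' b') :
    Congr (a * a') (b * b') := by
  refine ⟨by simpa using mul_le_one₀ h.1 (norm_nonneg _) h'.1, ?_⟩
  have : a * a' - b * b' = a * (a' - b') + (a - b) * b' := by ring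
  rw [this]
  refine (IsUltrametricDist.norm_add_le_max _ _).trans_lt (max_lt ?_ ?_) <;> rw [norm_mul]
  · exact (mul_le_of_le_one_left (norm_nonneg _) h.norm_le_one).trans_lt h'.2
  · exact (mul_le_of_le_one_right (norm_nonneg _) h'.1).trans_lt h.2

theorem Congr.pow {a b : L} (h : Congr a b) (n : ℕ) : Congr (a ^ n) (b ^ n) := by
  induction n with
  | zero => simpa using congr_refl (L := L) (a := 1) (by simp)
  | succ n ih => simpa [pow_succ] using ih.mul h

theorem Congr.prod {ι : Type*} {s : Finset ι} {a b : ι → L} (h : ∀ i ∈ s, Congr (a i) (b i)) :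
    Congr (∏ i ∈ s, a i) (∏ i ∈ s, b i) := by
  classical
  induction s using Finset.induction_on with
  | empty => simpa using congr_refl (L := L) (a := 1) (by simp)
  | insert i s hi ih =>
    rw [Finset.prod_insert hi, Finset.prod_insert hi]
    exact (h i (Finset.mem_insert_self i s)).mul (ih fun j hj => h j (Finset.mem_insert_of_mem hj))

theorem Congr.ne_zero {L : Type*} [NormedField L] {u : L} (h : Congr u 1) : u ≠ 0 := by
  rintro rfl
  simpa using h.2

theorem Congr.norm_eq_one {u : L} (h : Congr u 1) : ‖u‖ = 1 := by
  refine le_antisymm h.norm_le_one ?_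
  by_contra! hu
  have h1 := norm_sub_le_max u (u - 1)
  rw [sub_sub_cancel, norm_one] at h1
  exact absurd (h1.trans_lt (max_lt hu h.2)) (lt_irrefl _)

theorem Congr.inv {u : L} (h : Congr u 1) : Congr u⁻¹ 1 := by
  refine ⟨by simp, ?_⟩
  have : u⁻¹ - 1 = -(u⁻¹ * (u - 1)) := by
    field_simp [h.ne_zero]
    ring
  rw [this, norm_neg, norm_mul, norm_inv, h.norm_eq_one]
  simpa using h.2

theorem congr_one_sub {L : Type*} [NormedField L] {y : L} (h : ‖y‖ < 1) {n : ℕ} (hn : n ≠ 0) :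
    Congr (1 - y ^ n) 1 := by
  refine ⟨by simp, ?_⟩
  rw [sub_sub_cancel_left, norm_neg, norm_pow]
  exact pow_lt_one₀ (norm_nonneg _) h hn

end Congruence

/-! ### Reduction of `e_i / D_i` to the coefficient functionals. -/

section Field

variable {F : Type*} [Field F] [Finite F]

theorem one_lt_card_real : (1 : ℝ) < Nat.card F := by
  exact_mod_cast Finite.one_lt_card (α := F)

theorem norm_C_le_one (a : F) : ‖(HahnSeries.C a : LaurentSeries F)‖ ≤ 1 :=
  norm_map_le_one (HahnSeries.C : F →+* LaurentSeries F) a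

theorem norm_indet : ‖indet F‖ = (Nat.card F : ℝ)⁻¹ := by
  have h : indet F ≠ 0 := by simp [indet]
  rw [norm_eq_card_zpow h, indet, HahnSeries.order_single one_ne_zero, zpow_neg_one]

theorem indet_ne_zero {F : Type*} [Field F] : indet F ≠ 0 := by simp [indet]

theorem norm_indet_lt_one : ‖indet F‖ < 1 := by
  rw [norm_indet]
  exact inv_lt_one_of_one_lt₀ one_lt_card_real

/-- Discreteness of the value group of `K`: it upgrades each strict congruence to the uniform
contraction factor `q⁻¹`. -/
theorem norm_le_inv_card_of_lt_one {z : LaurentSeries F} (h : ‖z‖ < 1) :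
    ‖z‖ ≤ (Nat.card F : ℝ)⁻¹ := by
  by_cases hz : z = 0
  · simp [hz]
  · rw [norm_eq_card_zpow hz] at h ⊢
    rw [← zpow_neg_one]
    have := (zpow_lt_one_iff_right₀ (one_lt_card_real (F := F))).1 h
    exact zpow_le_zpow_right₀ one_lt_card_real.le (by omega)

theorem norm_le_one_iff {z : LaurentSeries F} : ‖z‖ ≤ 1 ↔ ∀ n : ℤ, n < 0 → z.coeff n = 0 := by
  simpa using norm_le_card_zpow_iff (z := z) (D := 0)

theorem exists_eq_C_add_indet_mul {t : LaurentSeries F} (ht : ‖t‖ ≤ 1) :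
    ∃ s : LaurentSeries F, ‖s‖ ≤ 1 ∧ t = HahnSeries.C (t.coeff 0) + indet F * s ∧
      -- The index `-1` is exceptional because the constant term of `t` is removed before shifting.
      ∀ i : ℤ, s.coeff i = if i = -1 then 0 else t.coeff (i + 1) := by
  have hcoeff : ∀ i : ℤ, (HahnSeries.single (-1 : ℤ) (1 : F) *
      (t - HahnSeries.C (t.coeff 0))).coeff i = if i = -1 then 0 else t.coeff (i + 1) := by
    intro i
    rw [HahnSeries.coeff_single_mul, one_mul, sub_neg_eq_add, HahnSeries.coeff_sub,
      HahnSeries.C_apply]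
    split_ifs with h
    · simp [h]
    · rw [HahnSeries.coeff_single_of_ne (by omega), sub_zero]
  refine ⟨_, ?_, ?_, hcoeff⟩
  · rw [norm_le_one_iff]
    intro n hn
    rw [hcoeff]
    split_ifs with h
    · rfl
    · exact norm_le_one_iff.1 ht _ (by omega)
  · rw [indet, ← mul_assoc, HahnSeries.single_mul_single]
    simp

theorem algebraMap_eq_C {F : Type*} [Field F] (a : F) :
    algebraMap F (LaurentSeries F) a = HahnSeries.C a := by
  rw [HahnSeries.algebraMap_apply']
  exact HahnSeries.ofPowerSeries_C a

theorem norm_aeval_indet_le_one (m : Polynomial F) : ‖Polynomial.aeval (indet F) m‖ ≤ 1 := by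
  rw [Polynomial.aeval_def, Polynomial.eval₂_eq_sum_range]
  refine IsUltrametricDist.norm_sum_le_of_forall_le_of_nonneg zero_le_one fun i _ => ?_
  rw [norm_mul, norm_pow, algebraMap_eq_C]
  exact mul_le_one₀ (norm_C_le_one _) (by positivity)
    (pow_le_one₀ (norm_nonneg _) norm_indet_lt_one.le)

variable (F) in
/-- The polynomials of degree less than `i`. -/
noncomputable def polysDegreeLT (i : ℕ) : Finset (Polynomial F) := (finite_degree_lt F i).toFinset

theorem mem_polysDegreeLT {i : ℕ} {m : Polynomial F} : m ∈ polysDegreeLT F i ↔ m.degree < i := by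
  simp [polysDegreeLT]

theorem card_polysDegreeLT (i : ℕ) : (polysDegreeLT F i).card = Nat.card F ^ i := by
  rw [polysDegreeLT, ← Set.ncard_eq_toFinset_card _ (finite_degree_lt F i), ← Nat.card_coe_set_eq]
  have : Nat.card (Polynomial.degreeLT F i) = Nat.card F ^ i := by
    rw [Nat.card_congr (Polynomial.degreeLTEquiv F i).toEquiv, Nat.card_fun, Nat.card_fin]
  rw [← this]
  exact Nat.card_congr (Equiv.subtypeEquivRight fun m => Polynomial.mem_degreeLT.symm)

theorem e_eq_prod (i : ℕ) (t : LaurentSeries F) :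
    e F i t = ∏ m ∈ polysDegreeLT F i, (t - Polynomial.aeval (indet F) m) :=
  finprod_mem_eq_finite_toFinset_prod _ _

theorem e_zero (t : LaurentSeries F) : e F 0 t = t := by
  have : polysDegreeLT F 0 = {0} := by
    ext m
    rw [mem_polysDegreeLT, Finset.mem_singleton, Nat.cast_zero, Nat.WithBot.lt_zero_iff,
      Polynomial.degree_eq_bot]
  simp [e_eq_prod, this]

theorem prod_polysDegreeLT_succ [Fintype F] {A : Type*} [CommMonoid A] (i : ℕ)
    (f : Polynomial F → A) :
    ∏ m ∈ polysDegreeLT F (i + 1), f m =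
      ∏ m ∈ polysDegreeLT F i, ∏ c : F, f (m * Polynomial.X + Polynomial.C c) := by
  rw [← Finset.prod_product']
  symm
  refine Finset.prod_nbij' (fun p => p.1 * Polynomial.X + Polynomial.C p.2)
    (fun m => (m.divX, m.coeff 0)) ?_ ?_ ?_ ?_ ?_
  · rintro ⟨m, c⟩ h
    simp only [Finset.mem_product, Finset.mem_univ, and_true, mem_polysDegreeLT] at h ⊢
    rw [Polynomial.degree_lt_iff_coeff_zero] at h ⊢
    intro k hk
    obtain ⟨k, rfl⟩ : ∃ l, k = l + 1 := ⟨k - 1, by omega⟩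
    simp [h k (by omega)]
  · intro m h
    simp only [Finset.mem_product, Finset.mem_univ, and_true, mem_polysDegreeLT] at h ⊢
    rw [Polynomial.degree_lt_iff_coeff_zero] at h ⊢
    intro k hk
    rw [Polynomial.coeff_divX]
    exact h _ (by omega)
  · rintro ⟨m, c⟩ -
    ext <;> simp [Polynomial.coeff_divX]
  · intro m _
    exact Polynomial.divX_mul_X_add m
  · intro p _
    rfl

theorem prod_sub_C [Fintype F] (y : LaurentSeries F) :
    ∏ c : F, (y - HahnSeries.C c) = y ^ Nat.card F - y := by
  have hdeg := FiniteField.X_pow_card_sub_X_natDegree_eq F (Finite.one_lt_card (α := F))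
  have hroots := FiniteField.roots_X_pow_card_sub_X F
  rw [← Nat.card_eq_fintype_card] at hroots
  have hmonic : (Polynomial.X ^ Nat.card F - Polynomial.X : Polynomial F).Monic :=
    Polynomial.monic_X_pow_sub (by simpa using Finite.one_lt_card (α := F))
  have h := Polynomial.prod_multiset_X_sub_C_of_monic_of_roots_card_eq hmonic (by
    rw [hroots, hdeg, Nat.card_eq_fintype_card]
    rfl)
  rw [hroots] at h
  have h' := congrArg (Polynomial.eval₂ (HahnSeries.C : F →+* LaurentSeries F) y) h
  change Polynomial.eval₂ _ _ (∏ c : F, (Polynomial.X - Polynomial.C c)) = _ at h'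
  simpa only [Polynomial.eval₂_finsetProd, Polynomial.eval₂_sub, Polynomial.eval₂_X,
    Polynomial.eval₂_C, Polynomial.eval₂_X_pow] using h'

theorem neg_one_pow_card_pow (i : ℕ) : (-1 : LaurentSeries F) ^ Nat.card F ^ i = -1 := by
  let _ := Fintype.ofFinite F
  have h : (-1 : F) ^ Nat.card F ^ i = -1 := by
    rw [Nat.card_eq_fintype_card]
    exact FiniteField.pow_card_pow i _
  have h' := congrArg (HahnSeries.C : F →+* LaurentSeries F) h
  rwa [map_pow, map_neg, map_one] at h'

theorem neg_pow_card_pow (z : LaurentSeries F) (i : ℕ) :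
    (-z) ^ Nat.card F ^ i = -z ^ Nat.card F ^ i := by
  rw [neg_pow, neg_one_pow_card_pow, neg_one_mul]

/-- Group the roots as `x m + c` with `c` constant. With `y = x (s - m)`, the product over `c` is
`y^q - y = -y (1 - y^{q-1})`, and `1 - y^{q-1}` is congruent to `1` since `|y| < 1`. The `q^i`
choices of `m` contribute `(-x)^{q^i} = -x^{q^i}` and rebuild `e_i(s)`. -/
theorem exists_e_succ_eq (i : ℕ) (a : F) {s : LaurentSeries F} (hs : ‖s‖ ≤ 1) :
    ∃ v, Congr v 1 ∧
      e F (i + 1) (HahnSeries.C a + indet F * s) = -indet F ^ Nat.card F ^ i * v * e F i s := by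
  let _ := Fintype.ofFinite F
  have hq : Nat.card F - 1 ≠ 0 := by
    have := Finite.one_lt_card (α := F)
    omega
  let y : Polynomial F → LaurentSeries F := fun m =>
    indet F * (s - Polynomial.aeval (indet F) m)
  have hy : ∀ m, ‖y m‖ < 1 := by
    intro m
    rw [norm_mul]
    refine (mul_le_of_le_one_right (norm_nonneg _) ?_).trans_lt norm_indet_lt_one
    exact (norm_sub_le_max _ _).trans (max_le hs (norm_aeval_indet_le_one m))
  refine ⟨∏ m ∈ polysDegreeLT F i, (1 - y m ^ (Nat.card F - 1)), ?_, ?_⟩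
  · simpa using Congr.prod (s := polysDegreeLT F i) (b := fun _ => 1)
      fun m _ => congr_one_sub (hy m) hq
  · have hinner : ∀ m : Polynomial F, ∏ c : F, (HahnSeries.C a + indet F * s -
        Polynomial.aeval (indet F) (m * Polynomial.X + Polynomial.C c)) =
        -indet F * (1 - y m ^ (Nat.card F - 1)) * (s - Polynomial.aeval (indet F) m) := by
      intro m
      have h1 : ∏ c : F, (HahnSeries.C a + indet F * s -
          Polynomial.aeval (indet F) (m * Polynomial.X + Polynomial.C c)) =
          ∏ c : F, (y m - HahnSeries.C c) := by
        -- The constant term `a` is absorbed by translating `c`.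
        refine Fintype.prod_equiv (Equiv.subRight a) _ _ fun c => ?_
        simp only [map_add, map_mul, Polynomial.aeval_X, Polynomial.aeval_C, algebraMap_eq_C,
          Equiv.subRight_apply, map_sub, y]
        ring
      rw [h1, prod_sub_C]
      have h2 : y m ^ Nat.card F = y m ^ (Nat.card F - 1) * y m := by
        rw [← pow_succ, Nat.sub_add_cancel Finite.one_lt_card.le]
      rw [h2]
      simp only [y]
      ring
    rw [e_eq_prod, prod_polysDegreeLT_succ, Finset.prod_congr rfl fun m _ => hinner m,
      Finset.prod_mul_distrib, Finset.prod_mul_distrib, Finset.prod_const, card_polysDegreeLT,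
      neg_pow_card_pow, e_eq_prod]

variable (F) in
/-- The leading term `∏_{j < i} (-x^{q^j})` of `D_i`. -/
noncomputable def leadD (i : ℕ) : LaurentSeries F :=
  ∏ j ∈ Finset.range i, -indet F ^ Nat.card F ^ j

theorem leadD_ne_zero {F : Type*} [Field F] (i : ℕ) : leadD F i ≠ 0 :=
  Finset.prod_ne_zero_iff.2 fun _ _ => neg_ne_zero.2 (pow_ne_zero _ indet_ne_zero)

theorem exists_bracket_eq {k : ℕ} (hk : k ≠ 0) :
    ∃ u, Congr u 1 ∧ bracket F k = -indet F * u := by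
  have hq : 1 < Nat.card F ^ k := Nat.one_lt_pow hk Finite.one_lt_card
  refine ⟨_, congr_one_sub norm_indet_lt_one (n := Nat.card F ^ k - 1) (by omega), ?_⟩
  have : indet F ^ Nat.card F ^ k = indet F ^ (Nat.card F ^ k - 1) * indet F := by
    rw [← pow_succ, Nat.sub_add_cancel hq.le]
  rw [bracket, this]
  ring

theorem exists_D_eq (i : ℕ) : ∃ u, Congr u 1 ∧ D F i = leadD F i * u := by
  -- The value `1` at `k = 0` only makes `u` total; the product for `D_i` starts at `k = 1`.
  have hex : ∀ k : ℕ, ∃ u, Congr u 1 ∧ (k ≠ 0 → bracket F k = -indet F * u) := by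
    intro k
    by_cases hk : k = 0
    · exact ⟨1, congr_refl (by simp), fun h => absurd hk h⟩
    · obtain ⟨u, hu, h⟩ := exists_bracket_eq (F := F) hk
      exact ⟨u, hu, fun _ => h⟩
  choose u hu hb using hex
  refine ⟨∏ k ∈ Finset.Icc 1 i, u k ^ Nat.card F ^ (i - k), ?_, ?_⟩
  · simpa using Congr.prod (s := Finset.Icc 1 i) (b := fun k => 1 ^ Nat.card F ^ (i - k))
      fun k _ => (hu k).pow _
  · have hlead : leadD F i = ∏ k ∈ Finset.Icc 1 i, -indet F ^ Nat.card F ^ (i - k) := by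
      refine Finset.prod_nbij' (fun j => i - j) (fun k => i - k) ?_ ?_ ?_ ?_ ?_ <;>
        simp only [Finset.mem_range, Finset.mem_Icc] <;> intro j hj
      · omega
      · omega
      · omega
      · omega
      · rw [Nat.sub_sub_self hj.le]
    rw [hlead, ← Finset.prod_mul_distrib]
    refine Finset.prod_congr rfl fun k hk => ?_
    rw [hb k (by have := Finset.mem_Icc.1 hk; omega), mul_pow, neg_pow_card_pow]

/-- Passing from `i` to `i + 1` multiplies both `e` and `leadD` by `-x^{q^i}`, up to a unit
congruent to `1`, while the shift from `t` to `s` turns coefficient `i + 1` into coefficient `i`. -/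
theorem congr_e_div_leadD (i : ℕ) {t : LaurentSeries F} (ht : ‖t‖ ≤ 1) :
    Congr (e F i t / leadD F i) (HahnSeries.C (t.coeff i)) := by
  induction i generalizing t with
  | zero =>
    obtain ⟨s, hs, hts, -⟩ := exists_eq_C_add_indet_mul ht
    refine ⟨norm_C_le_one _, ?_⟩
    have : e F 0 t / leadD F 0 - HahnSeries.C (t.coeff (0 : ℕ)) = indet F * s := by
      rw [e_zero, leadD, Finset.prod_range_zero, div_one, sub_eq_iff_eq_add']
      exact hts
    rw [this, norm_mul]
    exact (mul_le_of_le_one_right (norm_nonneg _) hs).trans_lt norm_indet_lt_one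
  | succ i ih =>
    obtain ⟨s, hs, hts, hc⟩ := exists_eq_C_add_indet_mul ht
    obtain ⟨v, hv, he⟩ := exists_e_succ_eq i (t.coeff 0) hs
    have h1 : e F (i + 1) t / leadD F (i + 1) = v * (e F i s / leadD F i) := by
      have hx : indet F ^ Nat.card F ^ i ≠ 0 := pow_ne_zero _ indet_ne_zero
      have hl := leadD_ne_zero (F := F) i
      have hl' : leadD F (i + 1) = leadD F i * -indet F ^ Nat.card F ^ i :=
        Finset.prod_range_succ _ _
      conv_lhs => rw [hts]
      rw [he, hl']
      field_simp
    have h2 : t.coeff ((i + 1 : ℕ) : ℤ) = s.coeff i := by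
      rw [hc, if_neg (by omega)]
      rfl
    rw [h1, h2]
    simpa using hv.mul (ih hs)

/-- Modulo the maximal ideal, `e_i / D_i` is the `i`-th coefficient functional. -/
theorem congr_e_div_D (i : ℕ) {t : LaurentSeries F} (ht : ‖t‖ ≤ 1) :
    Congr (e F i t / D F i) (HahnSeries.C (t.coeff i)) := by
  obtain ⟨u, hu, hD⟩ := exists_D_eq (F := F) i
  have : e F i t / D F i = e F i t / leadD F i * u⁻¹ := by
    rw [hD, div_mul_eq_div_div, div_eq_mul_inv _ u]
  rw [this]
  simpa using (congr_e_div_leadD i ht).mul hu.inv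

/-! ### From digits to the reduction of `h_j`. -/

theorem digit_eq_zero {F : Type*} {j i : ℕ} (h : j < Nat.card F ^ i) : digit F j i = 0 := by
  rw [digit, Nat.div_eq_of_lt h, Nat.zero_mod]

/-- Digits past the leading one vanish, so all `j < qⁿ` can share the same `n` variables. -/
theorem prod_range_log_pow_digit {A : Type*} [CommMonoid A] (f : ℕ → A) {n j : ℕ}
    (hj : j < Nat.card F ^ n) :
    ∏ i ∈ Finset.range (Nat.log (Nat.card F) j + 1), f i ^ digit F j i =
      ∏ i ∈ Finset.range n, f i ^ digit F j i := by
  have key : ∀ N M : ℕ, j < Nat.card F ^ N → N ≤ M →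
      ∏ i ∈ Finset.range N, f i ^ digit F j i = ∏ i ∈ Finset.range M, f i ^ digit F j i := by
    intro N M hN hNM
    refine Finset.prod_subset (Finset.range_subset_range.2 hNM) fun i _ hi => ?_
    have hi' : N ≤ i := not_lt.1 (Finset.mem_range.not.1 hi)
    rw [digit_eq_zero (hN.trans_le (Nat.pow_le_pow_right Nat.card_pos hi')), pow_zero]
  have hlog := Nat.lt_pow_succ_log_self (Finite.one_lt_card (α := F)) j
  rcases le_total n (Nat.log (Nat.card F) j + 1) with h | h
  · exact (key _ _ hj h).symm
  · exact key _ _ hlog h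

theorem congr_G_div_Gam {n j : ℕ} (hj : j < Nat.card F ^ n) {t : LaurentSeries F}
    (ht : ‖t‖ ≤ 1) :
    Congr (G F j t / Gam F j) (HahnSeries.C (digitMonomial n j fun i => t.coeff (i : ℕ))) := by
  have h1 : G F j t / Gam F j = ∏ i ∈ Finset.range n, (e F i t / D F i) ^ digit F j i := by
    rw [G, Gam, ← Finset.prod_div_distrib, ← prod_range_log_pow_digit _ hj]
    exact Finset.prod_congr rfl fun i _ => (div_pow _ _ _).symm
  have h2 : (HahnSeries.C (digitMonomial n j fun i => t.coeff (i : ℕ)) : LaurentSeries F) =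
      ∏ i ∈ Finset.range n, HahnSeries.C (t.coeff i) ^ digit F j i := by
    rw [digitMonomial, Finset.prod_range, map_prod]
    exact Finset.prod_congr rfl fun i _ => map_pow _ _ _
  rw [h1, h2]
  exact Congr.prod fun i _ => (congr_e_div_D i ht).pow _

end Field

/-! ### Orthonormality and density over the completed algebraic closure. -/

section Completed

variable {F : Type*} [Field F] [Finite F]

instance isUltrametricDist_algClosure : IsUltrametricDist (AlgClosure F) :=
  IsUltrametricDist.isUltrametricDist_of_isNonarchimedean_norm
    (isNonarchimedean_spectralNorm (K := LaurentSeries F) (L := AlgClosure F))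

instance isUltrametricDist_completedAlgClosure : IsUltrametricDist (CompletedAlgClosure F) := by
  refine IsUltrametricDist.isUltrametricDist_of_forall_norm_add_le_max_norm fun x y => ?_
  induction x, y using UniformSpace.Completion.induction_on₂ with
  | hp => exact isClosed_le (by fun_prop) (by fun_prop)
  | ih a b =>
    rw [← UniformSpace.Completion.coe_add]
    simp only [UniformSpace.Completion.norm_coe]
    exact IsUltrametricDist.norm_add_le_max a b

variable (F) in
/-- The embedding of `K` into `K̄`, as a ring homomorphism. -/
noncomputable def embedHom : LaurentSeries F →+* CompletedAlgClosure F :=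
  (UniformSpace.Completion.coeRingHom (α := AlgClosure F)).comp
    (algebraMap (LaurentSeries F) (AlgClosure F))

variable (F) in
/-- The embedding of the constants `F` into `K̄`. -/
noncomputable def embedConst : F →+* CompletedAlgClosure F := (embedHom F).comp HahnSeries.C

theorem embed_sub (a b : LaurentSeries F) : embed (a - b) = embed a - embed b :=
  map_sub (embedHom F) a b

theorem norm_coe_le_one (t : Integers F) : ‖t.1‖ ≤ 1 :=
  mem_closedBall_zero_iff.1 t.2

theorem exists_coeff_eq {n : ℕ} (a : Fin n → F) :
    ∃ t : Integers F, ∀ i : Fin n, t.1.coeff (i : ℕ) = a i := by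
  let p : PowerSeries F := PowerSeries.mk fun i => if hi : i < n then a ⟨i, hi⟩ else 0
  have hp : ∀ i : ℤ, (HahnSeries.ofPowerSeries ℤ F p).coeff i =
      if i < 0 then 0 else PowerSeries.coeff i.natAbs p := fun i => PowerSeries.coeff_coe p i
  refine ⟨⟨HahnSeries.ofPowerSeries ℤ F p, ?_⟩, fun i => ?_⟩
  · rw [Metric.mem_closedBall, dist_zero_right, norm_le_one_iff]
    intro i hi
    rw [hp, if_pos hi]
  · simp [hp, p]

theorem norm_h_sub_le {n j : ℕ} (hj : j < Nat.card F ^ n) (t : Integers F) :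
    ‖h F j t - embedConst F (digitMonomial n j fun i => t.1.coeff (i : ℕ))‖ ≤
      (Nat.card F : ℝ)⁻¹ := by
  have ht : ‖t.1‖ ≤ 1 := norm_coe_le_one t
  have := norm_le_inv_card_of_lt_one (congr_G_div_Gam hj ht).2
  rwa [← norm_embed, embed_sub] at this

theorem norm_h_le_one (j : ℕ) : ‖h F j‖ ≤ 1 := by
  rw [ContinuousMap.norm_le _ zero_le_one]
  intro t
  have ht : ‖t.1‖ ≤ 1 := norm_coe_le_one t
  have := (congr_G_div_Gam (Nat.lt_pow_self (Finite.one_lt_card (α := F)) (n := j)) ht).norm_le_one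
  rwa [← norm_embed] at this

/-- A combination of the `h_j` is within `q⁻¹` times the size of its coefficients of the same
combination of digit monomials. -/
theorem norm_sum_h_sub_le {n : ℕ} {c : ℕ → CompletedAlgClosure F} {M : ℝ} (hM : 0 ≤ M)
    (hc : ∀ j < Nat.card F ^ n, ‖c j‖ ≤ M) (t : Integers F) :
    ‖(∑ j ∈ Finset.range (Nat.card F ^ n), c j • h F j) t -
      ∑ j ∈ Finset.range (Nat.card F ^ n),
        c j * embedConst F (digitMonomial n j fun i => t.1.coeff (i : ℕ))‖ ≤
      M * (Nat.card F : ℝ)⁻¹ := by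
  rw [ContinuousMap.sum_apply, ← Finset.sum_sub_distrib]
  refine IsUltrametricDist.norm_sum_le_of_forall_le_of_nonneg (by positivity) fun j hj => ?_
  have hj' := Finset.mem_range.1 hj
  rw [ContinuousMap.smul_apply, smul_eq_mul, ← mul_sub, norm_mul]
  exact mul_le_mul (hc j hj') (norm_h_sub_le hj' t) (norm_nonneg _) hM

theorem norm_coeff_le_norm_sum_h (n : ℕ) (c : ℕ → CompletedAlgClosure F) (j : ℕ) (hj : j < n) :
    ‖c j‖ ≤ ‖∑ i ∈ Finset.range n, c i • h F i‖ := by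
  obtain ⟨i₀, hi₀, hmax⟩ := Finset.exists_max_image (Finset.range n) (fun i => ‖c i‖)
    ⟨j, Finset.mem_range.2 hj⟩
  refine (hmax j (Finset.mem_range.2 hj)).trans ?_
  by_contra! hlt
  have hn : n < Nat.card F ^ n := Nat.lt_pow_self Finite.one_lt_card
  -- Padding by zeros to length `qⁿ > n` gives exactly the full set of reduced monomials in `n`
  -- variables.
  let c' : ℕ → CompletedAlgClosure F := fun i => if i < n then c i else 0
  have hsum : ∑ i ∈ Finset.range n, c i • h F i =
      ∑ i ∈ Finset.range (Nat.card F ^ n), c' i • h F i := by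
    rw [← Finset.sum_subset (Finset.range_subset_range.2 hn.le)]
    · exact Finset.sum_congr rfl fun i hi => by simp [c', Finset.mem_range.1 hi]
    · intro i _ hi
      simp [c', (not_lt.1 (Finset.mem_range.not.1 hi)).not_gt]
  rw [hsum] at hlt
  have hM : 0 < ‖c i₀‖ := (norm_nonneg _).trans_lt hlt
  have hc' : ∀ i < Nat.card F ^ n, ‖c' i‖ ≤ ‖c i₀‖ := by
    intro i _
    by_cases hi : i < n
    · simpa [c', hi] using hmax i (Finset.mem_range.2 hi)
    · simp [c', hi]
  have hbound : ∀ a : Fin n → F,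
      ‖∑ j ∈ Finset.range (Nat.card F ^ n), c' j * embedConst F (digitMonomial n j a)‖ ≤
        max ‖∑ i ∈ Finset.range (Nat.card F ^ n), c' i • h F i‖
          (‖c i₀‖ * (Nat.card F : ℝ)⁻¹) := by
    intro a
    obtain ⟨t, hta⟩ := exists_coeff_eq a
    have h1 := norm_sum_h_sub_le hM.le hc' t
    simp only [hta] at h1
    have h2 := norm_sub_le_max ((∑ i ∈ Finset.range (Nat.card F ^ n), c' i • h F i) t)
      ((∑ i ∈ Finset.range (Nat.card F ^ n), c' i • h F i) t -
        ∑ j ∈ Finset.range (Nat.card F ^ n), c' j * embedConst F (digitMonomial n j a))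
    rw [sub_sub_cancel] at h2
    exact h2.trans (max_le_max (ContinuousMap.norm_coe_le_norm _ t) h1)
  have hi₀n := Finset.mem_range.1 hi₀
  have hfin := norm_le_of_sum_digitMonomial_le (embedConst F) hbound (hi₀n.trans hn)
  have hc₀ : c' i₀ = c i₀ := if_pos hi₀n
  rw [hc₀] at hfin
  -- If the sum were smaller than the largest coefficient, both terms of the maximum would be too,
  -- and inverting the monomials would bound that coefficient strictly below itself.
  refine absurd hfin (not_le.2 (max_lt hlt ?_))
  exact mul_lt_of_lt_one_right hM (inv_lt_one_of_one_lt₀ one_lt_card_real)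

theorem exists_mem_span_norm_sub_le (φ : C(Integers F, CompletedAlgClosure F)) :
    ∃ p ∈ Submodule.span (CompletedAlgClosure F) (Set.range (h F)),
      ‖φ - p‖ ≤ ‖φ‖ * (Nat.card F : ℝ)⁻¹ := by
  rcases eq_or_ne φ 0 with rfl | hφ
  · exact ⟨0, Submodule.zero_mem _, by simp⟩
  have hq := one_lt_card_real (F := F)
  have hpos : 0 < ‖φ‖ * (Nat.card F : ℝ)⁻¹ :=
    mul_pos (norm_pos_iff.2 hφ) (inv_pos.2 (zero_lt_one.trans hq))
  obtain ⟨δ, hδ, hφδ⟩ := Metric.uniformContinuous_iff.1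
    (CompactSpace.uniformContinuous_of_continuous φ.continuous) _ hpos
  -- Elements of `O` agreeing in their first `n` coefficients are within `q⁻ⁿ < δ`; `τ a` is a
  -- representative with coefficients `a`.
  obtain ⟨n, hn⟩ := exists_pow_lt_of_lt_one hδ (inv_lt_one_of_one_lt₀ hq)
  choose τ hτ using fun a : Fin n → F => exists_coeff_eq a
  obtain ⟨c, hc, hcφ⟩ := exists_sum_digitMonomial_eq (embedConst F) (f := fun a => φ (τ a))
    fun a => ContinuousMap.norm_coe_le_norm φ (τ a)
  refine ⟨∑ j ∈ Finset.range (Nat.card F ^ n), c j • h F j,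
    Submodule.sum_mem _ fun j _ => Submodule.smul_mem _ _ (Submodule.subset_span ⟨j, rfl⟩), ?_⟩
  rw [ContinuousMap.norm_le _ hpos.le]
  intro t
  let a : Fin n → F := fun i => t.1.coeff (i : ℕ)
  have hdist : dist t (τ a) < δ := by
    refine lt_of_le_of_lt ?_ hn
    rw [Subtype.dist_eq, dist_eq_norm]
    have := (norm_le_card_zpow_iff (z := t.1 - (τ a).1) (D := n)).2 fun k hk => ?_
    · simpa using this
    · rw [HahnSeries.coeff_sub]
      rcases lt_or_ge k 0 with hk0 | hk0
      · have h1 : ∀ s : Integers F, s.1.coeff k = 0 := fun s =>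
          norm_le_one_iff.1 (norm_coe_le_one s) k hk0
        rw [h1, h1, sub_zero]
      · obtain ⟨k, rfl⟩ := Int.eq_ofNat_of_zero_le hk0
        rw [hτ a ⟨k, by omega⟩, sub_self]
  have h1 : ‖φ t - φ (τ a)‖ ≤ ‖φ‖ * (Nat.card F : ℝ)⁻¹ := by
    rw [← dist_eq_norm]
    exact (hφδ hdist).le
  -- The interpolating coefficients are bounded by `‖φ‖`, so exchanging monomials for `h_j` also
  -- costs at most `‖φ‖ / q`.
  have h2 := norm_sum_h_sub_le (norm_nonneg φ) hc t
  rw [hcφ a] at h2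
  have h3 := norm_sub_le_max (φ t - φ (τ a))
    ((∑ j ∈ Finset.range (Nat.card F ^ n), c j • h F j) t - φ (τ a))
  rw [sub_sub_sub_cancel_right] at h3
  exact h3.trans (max_le h1 h2)

theorem exists_mem_span_norm_sub_le_pow (φ : C(Integers F, CompletedAlgClosure F)) (k : ℕ) :
    ∃ p ∈ Submodule.span (CompletedAlgClosure F) (Set.range (h F)),
      ‖φ - p‖ ≤ ‖φ‖ * (Nat.card F : ℝ)⁻¹ ^ k := by
  induction k with
  | zero => exact ⟨0, Submodule.zero_mem _, by simp⟩
  | succ k ih =>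
    obtain ⟨p, hp, hpk⟩ := ih
    obtain ⟨p', hp', h'⟩ := exists_mem_span_norm_sub_le (φ - p)
    refine ⟨p + p', Submodule.add_mem _ hp hp', ?_⟩
    rw [← sub_sub, pow_succ, ← mul_assoc]
    exact h'.trans (mul_le_mul_of_nonneg_right hpk (by positivity))

theorem exists_norm_sub_sum_h_le (φ : C(Integers F, CompletedAlgClosure F)) (ε : ℝ) (hε : 0 < ε) :
    ∃ (n : ℕ) (c : ℕ → CompletedAlgClosure F),
      ‖φ - ∑ i ∈ Finset.range n, c i • h F i‖ ≤ ε := by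
  have hlim : Tendsto (fun k : ℕ => ‖φ‖ * (Nat.card F : ℝ)⁻¹ ^ k) atTop (𝓝 (‖φ‖ * 0)) :=
    (tendsto_pow_atTop_nhds_zero_of_lt_one (by positivity)
      (inv_lt_one_of_one_lt₀ one_lt_card_real)).const_mul _
  rw [mul_zero] at hlim
  obtain ⟨k, hk⟩ := (hlim.eventually_lt_const hε).exists
  obtain ⟨p, hp, hpk⟩ := exists_mem_span_norm_sub_le_pow φ k
  obtain ⟨c, rfl⟩ := Finsupp.mem_span_range_iff_exists_finsupp.1 hp
  obtain ⟨n, hn⟩ := c.support.exists_nat_subset_range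
  refine ⟨n, c, ?_⟩
  rw [← Finsupp.sum_of_support_subset c hn (fun i a => a • h F i) fun i _ => zero_smul _ _]
  exact hpk.trans hk.le

end Completed

end Carlitz

theorem proposition2 (F : Type*) [Field F] [Finite F] :
    Carlitz.IsOrthonormalBasis (E := C(Carlitz.Integers F, Carlitz.CompletedAlgClosure F))
      (Carlitz.CompletedAlgClosure F) (Carlitz.h F) := by
  exact Carlitz.isOrthonormalBasis_of_dense Carlitz.norm_h_le_one Carlitz.norm_coeff_le_norm_sum_h
    Carlitz.exists_norm_sub_sum_h_le
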